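/- Let $n\ge 1$, let $x_k=\cos\frac{(2k-1)\pi}{2n}$ ($1\le k\le n$) be the Chebyshev nodes, let $l_k(x)=\prod_{j\ne k}\frac{x-x_j}{x_k-x_j}$, and let $L_n:C[-1,1]\to C[-1,1]$, $L_n(f;x)=\sum_{k=1}^n f(x_k)\,l_k(x)$, be the Lagrange interpolation operator, with operator norm $\|L_n\|$ with respect to the sup norm. For $f\in C[-1,1]$ and $0\le t\le 2$ put $\omega(f;t)=\sup\{|f(u)-f(v)| : u,v\in[-1,1],\ |u-v|\le t\}$ and let $$\widetilde\omega(f;t)=\sup_{0\le a\le t\le b\le 2,\ a\ne b}\frac{(t-a)\,\omega(f;b)+(b-t)\,\omega(f;a)}{b-a}$$ be its least concave majorant on $[0,2]$. Then for all $f,g\in C[-1,1]$ and all $x\in[-1,1]$, $$\begin{aligned} |L_n(fg;x)-L_n(f;x)\,L_n(g;x)| &\le \tfrac14\,\|L_n\|\,(1+\|L_n\|)\,\widetilde\omega(f;2)\,\widetilde\omega(g;2)\\ &\le \tfrac12\Bigl(1+\tfrac{3}{\pi}\log n+\tfrac{2}{\pi^2}\log^2 n\Bigr)\,\omega(f;2)\,\omega(g;2)\\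 &\le \tfrac12\Bigl(1+\tfrac{3}{\pi}\log n+\tfrac{2}{\pi}\log^2 n\Bigr)\,\omega(f;2)\,\omega(g;2). \end{aligned}$$ -/

import Mathlib

open Set

noncomputable section

/-- The usual modulus of continuity `ω(f;t) = sup {|f x - f y| : d(x,y) ≤ t}` of a continuous
function on a compact metric space. -/
def modulus {X : Type*} [MetricSpace X] [CompactSpace X] (f : C(X, ℝ)) (t : ℝ) : ℝ :=
  sSup {r : ℝ | ∃ x y : X, dist x y ≤ t ∧ r = |f x - f y|}

/-- The least concave majorant `ω̃(f;t)` of the modulus of continuity; here `d(X)` is the diameter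
of the whole space. -/
def modulusMajorant {X : Type*} [MetricSpace X] [CompactSpace X] (f : C(X, ℝ)) (t : ℝ) : ℝ :=
  if t ≤ Metric.diam (univ : Set X) then
    sSup {r : ℝ | ∃ a b : ℝ, 0 ≤ a ∧ a ≤ t ∧ t ≤ b ∧ b ≤ Metric.diam (univ : Set X) ∧ a ≠ b ∧
      r = ((t - a) * modulus f b + (b - t) * modulus f a) / (b - a)}
  else modulus f (Metric.diam (univ : Set X))

/-- The `k`-th Lagrange fundamental function `∏_{j ≠ k} (t - x_j) / (x_k - x_j)` of a system of
nodes in `[-1,1]`, as a continuous function on `[-1,1]`. -/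
def lagrangeFundamental {n : ℕ} (x : Fin n → Icc (-1 : ℝ) 1) (k : Fin n) :
    C(Icc (-1 : ℝ) 1, ℝ) :=
  (Lagrange.basis Finset.univ (fun j => (x j : ℝ)) k).toContinuousMapOn (Icc (-1 : ℝ) 1)

/-- The Lagrange operator `L f = ∑ₖ f(x_k) l_k`, as a bounded linear operator on `C[-1,1]`
with the sup norm. -/
def lagrangeOperator {n : ℕ} (x : Fin n → Icc (-1 : ℝ) 1) :
    C(Icc (-1 : ℝ) 1, ℝ) →L[ℝ] C(Icc (-1 : ℝ) 1, ℝ) :=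
  ∑ k, (ContinuousMap.evalCLM ℝ (x k)).smulRight (lagrangeFundamental x k)

theorem lagrangeOperator_apply {n : ℕ} (x : Fin n → Icc (-1 : ℝ) 1) (f : C(Icc (-1 : ℝ) 1, ℝ))
    (t : Icc (-1 : ℝ) 1) :
    lagrangeOperator x f t = ∑ k, f (x k) * lagrangeFundamental x k t := by
  simp [lagrangeOperator, ContinuousMap.sum_apply]

/-- The Chebyshev nodes `x_k = cos ((2k-1)π / (2n))`, `k = 1, …, n`; the index `k : Fin n`
runs over `0, …, n-1`, so the formula is used at `k + 1`. -/
def chebyshevNode (n : ℕ) (k : Fin n) : Icc (-1 : ℝ) 1 :=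
  ⟨Real.cos ((2 * ((k : ℝ) + 1) - 1) / (2 * (n : ℝ)) * Real.pi),
    Real.neg_one_le_cos _, Real.cos_le_one _⟩

/-- The Lagrange operator `L_n` at the `n` Chebyshev nodes. -/
def chebyshevLagrange (n : ℕ) : C(Icc (-1 : ℝ) 1, ℝ) →L[ℝ] C(Icc (-1 : ℝ) 1, ℝ) :=
  lagrangeOperator (chebyshevNode n)

/-- The generalized Chebyshev functional `T(f,g;x) = H(fg;x) - H(f;x) H(g;x)` of an operator
`H` on `C(X)`. -/
def chebyshevFunctional {X : Type*} [MetricSpace X] [CompactSpace X]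
    (H : C(X, ℝ) →L[ℝ] C(X, ℝ)) (f g : C(X, ℝ)) (x : X) : ℝ :=
  H (f * g) x - H f x * H g x

end

/-! Since `L_n 1 = 1`, the functional is unchanged when constants are subtracted from `f` and `g`.
Subtracting the midpoints of their ranges makes the sup norms at most half the oscillations, so the
crude bound `‖L‖ (1 + ‖L‖) ‖f‖ ‖g‖` yields the factor 1/4. At `t = 2` the majorant equals the
modulus.

The rest is the Lebesgue constant bound `‖L_n‖ ≤ 1 + (2/π) log n`. At `cos t` the Lebesgue function
is `|cos nt| / n` times a sum dominated by half-angle cotangents at `2n` equally spaced angles. That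
sum is `π/n`-periodic in `t`, so `t` moves to some `|s| < π/(2n)`, where the domination is an
equality. There `cos s` lies to the right of all nodes, where the Lebesgue function increases up to
the endpoint 1. Its value at 1 is a cotangent sum, compared with the primitive `log ∘ sin`. -/

/-! ### Estimate of the cotangent sum -/

theorem two_mul_le_log_one_add_sub_log_one_sub {r : ℝ} (h0 : 0 ≤ r) (h1 : r < 1) :
    2 * r ≤ Real.log (1 + r) - Real.log (1 - r) := by
  have h := Real.hasSum_log_sub_log_of_abs_lt_one (x := r) (by rwa [abs_of_nonneg h0])
  -- Only the first term of the odd power series is kept.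
  have := sum_le_hasSum {0} (fun k _ => by positivity) h
  simpa using this

/-- Midpoint rule for the convex function `cot`, whose primitive is `log ∘ sin`. -/
theorem two_mul_cot_le_log_sin_sub {m d : ℝ} (hd : 0 < d) (hdm : d < m) (hm : m < Real.pi / 2) :
    2 * d * Real.cot m ≤ Real.log (Real.sin (m + d)) - Real.log (Real.sin (m - d)) := by
  have hsm : 0 < Real.sin m := Real.sin_pos_of_pos_of_lt_pi (by linarith) (by linarith)
  have hcm : 0 < Real.cos m := Real.cos_pos_of_mem_Ioo ⟨by linarith, hm⟩
  have hcd : 0 < Real.cos d := Real.cos_pos_of_mem_Ioo ⟨by linarith, by linarith⟩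
  have hsd : 0 < Real.sin (m - d) :=
    Real.sin_pos_of_pos_of_lt_pi (by linarith) (by linarith)
  -- Chosen so that `sin (m ± d) = sin m * cos d * (1 ± r)`.
  set r := Real.tan d * Real.cot m with hr
  have htan : d ≤ Real.tan d := Real.le_tan hd.le (by linarith)
  have hcot : 0 < Real.cot m := by rw [Real.cot_eq_cos_div_sin]; positivity
  have h0 : 0 ≤ r := mul_nonneg (hd.le.trans htan) hcot.le
  have e1 : Real.sin (m + d) = Real.sin m * Real.cos d * (1 + r) := by
    rw [Real.sin_add, hr, Real.tan_eq_sin_div_cos, Real.cot_eq_cos_div_sin]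
    field_simp
  have e2 : Real.sin (m - d) = Real.sin m * Real.cos d * (1 - r) := by
    rw [Real.sin_sub, hr, Real.tan_eq_sin_div_cos, Real.cot_eq_cos_div_sin]
    field_simp
  have h1 : r < 1 := by
    rw [e2] at hsd
    have := (mul_pos_iff_of_pos_left (mul_pos hsm hcd)).1 hsd
    linarith
  have hp : Real.sin m * Real.cos d ≠ 0 := (mul_pos hsm hcd).ne'
  rw [e1, e2, Real.log_mul hp (by linarith), Real.log_mul hp (by linarith)]
  have := two_mul_le_log_one_add_sub_log_one_sub h0 h1
  have := mul_le_mul_of_nonneg_right htan hcot.le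
  linarith

theorem mul_cot_le_one_sub {x : ℝ} (h0 : 0 < x) (h1 : x ≤ 1) : x * Real.cot x ≤ 1 - x ^ 2 / 3 := by
  have hs : 0 < Real.sin x := Real.sin_pos_of_pos_of_le_one h0 h1
  rw [Real.cot_eq_cos_div_sin, mul_div_assoc', div_le_iff₀ hs]
  have hc := (abs_le.1 (Real.cos_bound (x := x) (by rwa [abs_of_pos h0]))).2
  rw [abs_of_pos h0] at hc
  have hsin := Real.sin_ge_sub_cube h0.le
  have hx2 : x ^ 2 ≤ 1 := pow_le_one₀ h0.le h1
  calc x * Real.cos x ≤ x * (1 - x ^ 2 / 2 + x ^ 4 * (5 / 96)) := by gcongr; linarith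
    _ ≤ (1 - x ^ 2 / 3) * (x - x ^ 3 / 6) := by
      have : 0 ≤ x ^ 5 := by positivity
      nlinarith
    _ ≤ _ := by gcongr; linarith

theorem log_pi_div_two_gt : 0.4414 < Real.log (Real.pi / 2) := by
  have hpi := Real.pi_gt_d4
  have he := Real.exp_one_lt_d9
  -- This quotient is close to 1, where `1 - 1/y ≤ log y` is sharp.
  have hy : 0 < (Real.pi / 2) ^ 2 / Real.exp 1 := by positivity
  have h := Real.one_sub_inv_le_log_of_pos hy
  rw [Real.log_div (by positivity) (by positivity), Real.log_pow, Real.log_exp, inv_div] at h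
  have : Real.exp 1 / (Real.pi / 2) ^ 2 ≤ 1.11 := by
    rw [div_le_iff₀ (by positivity)]
    nlinarith
  push_cast at h
  linarith

/-- The midpoint rule on the intervals `[2kd, 2(k+1)d]` telescopes up to `log (sin (π/2)) = 0`. The
term `k = 0` is kept apart, `log ∘ sin` being singular at 0. -/
theorem sum_cot_le {n : ℕ} (hn : 1 ≤ n) {d : ℝ} (hd : d = Real.pi / (4 * n)) :
    ∑ k ∈ Finset.range n, 2 * d * Real.cot ((2 * k + 1) * d) ≤
      2 * (d * Real.cot d) - Real.log (Real.sin (2 * d)) := by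
  obtain ⟨m, rfl⟩ : ∃ m, n = m + 1 := ⟨n - 1, by omega⟩
  have hpi := Real.pi_pos
  have hd0 : 0 < d := by rw [hd]; positivity
  have hdn : (m + 1) * d = Real.pi / 4 := by rw [hd]; push_cast; field_simp
  have key : ∀ k ∈ Finset.range m, 2 * d * Real.cot ((2 * (k + 1 : ℕ) + 1) * d) ≤
      Real.log (Real.sin (2 * (((k + 1 : ℕ) : ℝ) + 1) * d)) -
        Real.log (Real.sin (2 * ((k : ℝ) + 1) * d)) := by
    intro k hk
    have hk' : (k : ℝ) + 1 ≤ m := by exact_mod_cast Finset.mem_range.1 hk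
    have := two_mul_cot_le_log_sin_sub (m := (2 * (k + 1 : ℕ) + 1) * d) hd0
      (by push_cast; nlinarith [mul_nonneg (Nat.cast_nonneg (α := ℝ) k) hd0.le])
      (by push_cast; nlinarith)
    convert this using 3 <;> congr 1 <;> push_cast <;> ring
  have hsum := Finset.sum_le_sum key
  rw [Finset.sum_range_sub (fun k : ℕ => Real.log (Real.sin (2 * ((k : ℝ) + 1) * d)))] at hsum
  have e : Real.sin (2 * ((m : ℝ) + 1) * d) = 1 := by
    rw [mul_assoc, hdn, ← Real.sin_pi_div_two]; congr 1; ring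
  rw [e, Real.log_one] at hsum
  rw [Finset.sum_range_succ']
  simp only [Nat.cast_zero, zero_add, mul_one, mul_zero, one_mul] at hsum ⊢
  linarith

/-- The bound for the Lebesgue constant of the Chebyshev nodes, in its closed form. -/
theorem inv_mul_sum_cot_le {n : ℕ} (hn : 1 ≤ n) :
    (n : ℝ)⁻¹ * ∑ k ∈ Finset.range n, Real.cot ((2 * k + 1) * (Real.pi / (4 * n))) ≤
      1 + 2 / Real.pi * Real.log n := by
  rcases hn.eq_or_lt with rfl | hn2
  · simp [Real.cot_eq_cos_div_sin]
  have hn2' : (2 : ℝ) ≤ n := by exact_mod_cast hn2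
  have hn0 : (0 : ℝ) < n := by linarith
  have hpi := Real.pi_pos
  set d := Real.pi / (4 * n) with hd
  have hd0 : 0 < d := by positivity
  have hpi1 := Real.pi_gt_d4
  have hpi2 := Real.pi_lt_d4
  have hd1 : d ≤ 0.393 := by
    rw [hd, div_le_iff₀ (by positivity)]; nlinarith
  have hnd : (n : ℝ) = Real.pi / (4 * d) := by rw [hd]; field_simp
  have hs := sum_cot_le hn hd
  rw [← Finset.mul_sum] at hs
  have hcot := mul_cot_le_one_sub hd0 (by linarith)
  have hsin := Real.sin_ge_sub_cube (x := 2 * d) (by linarith)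
  -- The relative cubic error of `sin (2 * d)`, and also twice the defect `d ^ 2 / 3` in the bound
  -- for `d * cot d`.
  set u := 2 * d ^ 2 / 3 with hu
  have hu0 : 0 ≤ u := by positivity
  have hu1 : u ≤ 0.104 := by rw [hu]; nlinarith
  have hsin' : 2 * d * (1 - u) ≤ Real.sin (2 * d) := by rw [hu]; nlinarith
  have hlog : Real.log (2 * d * (1 - u)) ≤ Real.log (Real.sin (2 * d)) :=
    Real.log_le_log (mul_pos (by linarith) (by linarith)) hsin'
  have hinv := Real.one_sub_inv_le_log_of_pos (x := 1 - u) (by linarith)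
  have hinv2 : (1 - u)⁻¹ ≤ 1 + u + 0.0121 := by
    rw [inv_le_iff_one_le_mul₀ (by linarith)]; nlinarith
  have hlogn : Real.log n = Real.log (Real.pi / 2) - Real.log (2 * d) := by
    rw [← Real.log_div (by positivity) (by positivity), hnd]; congr 1; field_simp; norm_num
  rw [Real.log_mul (by positivity) (by linarith)] at hlog
  have hL := log_pi_div_two_gt
  -- The two contributions of `u` cancel, leaving `2.0121 ≤ π/2 + 0.4414`.
  have hfin : 2 * d * ∑ k ∈ Finset.range n, Real.cot ((2 * k + 1) * d) ≤
      Real.pi / 2 + Real.log n := by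
    rw [hlogn]; linarith
  have e : (n : ℝ)⁻¹ = 2 / Real.pi * (2 * d) := by rw [hd]; field_simp; norm_num
  rw [e, mul_assoc]
  calc _ ≤ 2 / Real.pi * (Real.pi / 2 + Real.log n) := by gcongr
    _ = _ := by field_simp

/-! ### Chebyshev nodes and their fundamental polynomials -/

/-- The angle `(2k+1)π/(2n)` of the Chebyshev node with (zero-based) index `k`. -/
noncomputable def chebyshevAngle (n k : ℕ) : ℝ := (2 * k + 1) * Real.pi / (2 * n)

theorem chebyshevNode_eq_cos {n : ℕ} (k : Fin n) :
    (chebyshevNode n k : ℝ) = Real.cos (chebyshevAngle n k) := by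
  simp only [chebyshevNode, chebyshevAngle]
  congr 1
  ring

theorem chebyshevAngle_pos {n k : ℕ} (hn : 1 ≤ n) : 0 < chebyshevAngle n k := by
  have := Real.pi_pos
  have : (0 : ℝ) < n := by exact_mod_cast hn
  unfold chebyshevAngle
  positivity

theorem chebyshevAngle_lt_pi {n k : ℕ} (hk : k < n) : chebyshevAngle n k < Real.pi := by
  have h1 : (k : ℝ) + 1 ≤ n := by exact_mod_cast hk
  have h2 : (0 : ℝ) ≤ k := k.cast_nonneg
  have := Real.pi_pos
  unfold chebyshevAngle
  rw [div_lt_iff₀ (by linarith)]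
  nlinarith

theorem sin_chebyshevAngle_pos {n k : ℕ} (hk : k < n) : 0 < Real.sin (chebyshevAngle n k) :=
  Real.sin_pos_of_pos_of_lt_pi (chebyshevAngle_pos (by omega)) (chebyshevAngle_lt_pi hk)

theorem chebyshevNode_injective (n : ℕ) :
    Function.Injective (fun k : Fin n => (chebyshevNode n k : ℝ)) := by
  intro i j h
  simp only [chebyshevNode_eq_cos] at h
  have hn : 1 ≤ n := by have := i.2; omega
  have hn0 : (n : ℝ) ≠ 0 := by positivity
  have h' := Real.injOn_cos ⟨(chebyshevAngle_pos hn).le, (chebyshevAngle_lt_pi i.2).le⟩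
    ⟨(chebyshevAngle_pos hn).le, (chebyshevAngle_lt_pi j.2).le⟩ h
  unfold chebyshevAngle at h'
  have hpi := Real.pi_ne_zero
  field_simp at h'
  have : ((i : ℕ) : ℝ) = (j : ℕ) := by linarith
  exact Fin.ext (by exact_mod_cast this)

theorem chebyshev_T_eq_C_mul_nodal (n : ℕ) :
    Polynomial.Chebyshev.T ℝ n = Polynomial.C (2 ^ (n - 1)) *
      Lagrange.nodal Finset.univ (fun k : Fin n => (chebyshevNode n k : ℝ)) := by
  have hroots := Polynomial.Chebyshev.roots_T_real n
  rw [Finset.image_val_of_injOn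
    ((Finset.range n).nodup_map_iff_injOn.mp (Polynomial.Chebyshev.roots_T_real_nodup n))] at hroots
  have h := Polynomial.C_leadingCoeff_mul_prod_multiset_X_sub_C
    (p := Polynomial.Chebyshev.T ℝ n) (by simp [hroots])
  rw [← h, Polynomial.Chebyshev.leadingCoeff_T, hroots, Multiset.map_map, Lagrange.nodal]
  congr 1
  simp only [chebyshevNode_eq_cos]
  rw [Fin.prod_univ_eq_prod_range
    (fun k => Polynomial.X - Polynomial.C (Real.cos (chebyshevAngle n k)))]
  rfl

theorem abs_sin_mul_chebyshevAngle {n k : ℕ} (hn : 1 ≤ n) :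
    |Real.sin (n * chebyshevAngle n k)| = 1 := by
  have hn0 : (n : ℝ) ≠ 0 := by positivity
  have e : (n : ℝ) * chebyshevAngle n k = Real.pi / 2 + k * Real.pi := by
    unfold chebyshevAngle; field_simp; ring
  rw [e, Real.sin_add_nat_mul_pi]
  simp

/-- The Lagrange fundamental polynomials of the Chebyshev nodes, off the nodes. -/
theorem abs_eval_basis_chebyshevNode {n : ℕ} (k : Fin n) {t : ℝ}
    (ht : Real.cos t ≠ Real.cos (chebyshevAngle n k)) :
    |(Lagrange.basis Finset.univ (fun j : Fin n => (chebyshevNode n j : ℝ)) k).eval (Real.cos t)| =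
      (n : ℝ)⁻¹ * (|Real.cos (n * t)| * Real.sin (chebyshevAngle n k) /
        |Real.cos t - Real.cos (chebyshevAngle n k)|) := by
  have hn : 1 ≤ n := by have := k.2; omega
  have hn0 : (0 : ℝ) < n := by exact_mod_cast hn
  have hT := chebyshev_T_eq_C_mul_nodal n
  set v := fun j : Fin n => (chebyshevNode n j : ℝ) with hv
  have hvk : v k = Real.cos (chebyshevAngle n k) := chebyshevNode_eq_cos k
  have hsin := sin_chebyshevAngle_pos k.2
  have h1 : Real.cos (n * t) = 2 ^ (n - 1) * (Lagrange.nodal Finset.univ v).eval (Real.cos t) := by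
    have := Polynomial.Chebyshev.T_real_cos t n
    rw [hT] at this
    simpa using this.symm
  -- From `T' = n U` and `U(cos ψ) sin ψ = sin nψ`; this gives the nodal weight, as `|sin nψ| = 1`
  -- at a node.
  have h2 : n * Real.sin (n * chebyshevAngle n k) = 2 ^ (n - 1) *
      (Polynomial.derivative (Lagrange.nodal Finset.univ v)).eval (v k) *
        Real.sin (chebyshevAngle n k) := by
    have h := Polynomial.Chebyshev.U_real_cos (chebyshevAngle n k) (n - 1)
    have hd := congrArg (Polynomial.eval (v k)) (Polynomial.Chebyshev.T_derivative_eq_U (R := ℝ) n)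
    rw [hT] at hd
    simp only [Polynomial.derivative_mul, Polynomial.derivative_C, zero_mul, zero_add,
      Polynomial.eval_mul, Polynomial.eval_C] at hd
    rw [hd, hvk, mul_assoc, h]
    simp
  rw [Lagrange.eval_basis_not_at_node (Finset.mem_univ k) (by rwa [hvk]),
    Lagrange.nodalWeight_eq_eval_derivative_nodal (Finset.mem_univ k)]
  have h3 := congrArg abs h2
  rw [abs_mul, abs_sin_mul_chebyshevAngle hn, abs_mul, abs_mul, abs_of_pos hn0,
    abs_of_pos hsin] at h3
  rw [h1, abs_mul, abs_mul, abs_mul, abs_inv, abs_inv, hvk]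
  rw [hvk] at h3
  have hp : |(2 : ℝ) ^ (n - 1)| ≠ 0 := by positivity
  have hD : |(Polynomial.derivative (Lagrange.nodal Finset.univ v)).eval
      (Real.cos (chebyshevAngle n k))| ≠ 0 := by
    intro h; rw [h] at h3; simp at h3; omega
  have hx : |Real.cos t - Real.cos (chebyshevAngle n k)| ≠ 0 := abs_ne_zero.2 (sub_ne_zero.2 ht)
  have h4 : (n : ℝ) = |2 ^ (n - 1)| * |(Polynomial.derivative (Lagrange.nodal Finset.univ v)).eval
      (Real.cos (chebyshevAngle n k))| * Real.sin (chebyshevAngle n k) := by linarith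
  have hs0 := hsin.ne'
  rw [h4]
  field_simp

/-! ### Half-angle cotangents and their periodicity -/

theorem sin_div_cos_sub_cos {t p : ℝ} (h1 : Real.sin ((t - p) / 2) ≠ 0)
    (h2 : Real.sin ((t + p) / 2) ≠ 0) :
    Real.sin p / (Real.cos t - Real.cos p) =
      (Real.cot ((t + p) / 2) - Real.cot ((t - p) / 2)) / 2 := by
  rw [Real.cos_sub_cos, Real.cot_eq_cos_div_sin, Real.cot_eq_cos_div_sin]
  have e : Real.sin p = Real.sin ((t + p) / 2 - (t - p) / 2) := by congr 1; ring
  rw [e, Real.sin_sub]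
  field_simp
  ring

/-- Adding the reflected angles `2π - ψ` of the Chebyshev angles `ψ` gives `2n` equally spaced ones. -/
theorem sum_pair_eq_sum_range_two_mul (n : ℕ) (hn : 1 ≤ n) (t : ℝ) :
    ∑ k ∈ Finset.range n, (|Real.cot ((t + chebyshevAngle n k) / 2)| +
        |Real.cot ((t - chebyshevAngle n k) / 2)|) =
      ∑ j ∈ Finset.range (2 * n), |Real.cot ((t - chebyshevAngle n j) / 2)| := by
  have hn0 : (n : ℝ) ≠ 0 := by positivity
  rw [two_mul, Finset.sum_range_add, Finset.sum_add_distrib, add_comm]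
  congr 1
  rw [← Finset.sum_range_reflect]
  refine Finset.sum_congr rfl fun k hk => ?_
  have hk := Finset.mem_range.1 hk
  -- Angle `n + k` is `2π` minus angle `n - 1 - k`, and `cot` has period `π`.
  have e : (t - chebyshevAngle n (n + k)) / 2 =
      (t + chebyshevAngle n (n - 1 - k)) / 2 - Real.pi := by
    have : ((n - 1 - k : ℕ) : ℝ) = n - 1 - k := by
      rw [Nat.cast_sub (by omega), Nat.cast_sub hn]; simp
    unfold chebyshevAngle
    rw [this]
    push_cast
    field_simp
    ring
  rw [e, Real.cot_eq_cos_div_sin, Real.cot_eq_cos_div_sin, Real.cos_sub_pi, Real.sin_sub_pi,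
    neg_div_neg_eq]

theorem sum_range_add_eq_of_periodic {a : ℕ → ℝ} {N : ℕ} (ha : Function.Periodic a N) (m : ℕ) :
    ∑ j ∈ Finset.range N, a (j + m) = ∑ j ∈ Finset.range N, a j := by
  induction m with
  | zero => rfl
  | succ m ih =>
    rw [← ih]
    have h := Finset.sum_range_succ (fun j => a (j + m)) N
    rw [Finset.sum_range_succ', zero_add, add_comm N m, ha m] at h
    have := add_right_cancel h
    rw [← this]
    exact Finset.sum_congr rfl fun j _ => by congr 1; ring

/-- A shift by `π/n` only moves each angle to the next, and `2n` consecutive angles fill a full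
period. -/
theorem sum_abs_cot_shift {n : ℕ} (hn : 1 ≤ n) (t : ℝ) (m : ℕ) :
    ∑ j ∈ Finset.range (2 * n), |Real.cot ((t + m * Real.pi / n - chebyshevAngle n j) / 2)| =
      ∑ j ∈ Finset.range (2 * n), |Real.cot ((t - chebyshevAngle n j) / 2)| := by
  have hn0 : (n : ℝ) ≠ 0 := by positivity
  rw [← sum_range_add_eq_of_periodic _ m]
  · refine Finset.sum_congr rfl fun j _ => ?_
    have e : t + m * Real.pi / n - chebyshevAngle n (j + m) = t - chebyshevAngle n j := by
      unfold chebyshevAngle; push_cast; field_simp; ring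
    rw [e]
  · intro j
    have e : (t + m * Real.pi / n - chebyshevAngle n (j + 2 * n)) / 2 =
        (t + m * Real.pi / n - chebyshevAngle n j) / 2 - Real.pi := by
      unfold chebyshevAngle; push_cast; field_simp; ring
    simp only [e, Real.cot_eq_cos_div_sin, Real.cos_sub_pi, Real.sin_sub_pi, neg_div_neg_eq]

/-- The two cotangents have opposite signs here, so the triangle inequality is an equality. -/
theorem abs_cot_add_abs_cot {t p : ℝ} (ht : |t| < p) (hp : |t| + p < Real.pi) :
    |Real.cot ((t + p) / 2)| + |Real.cot ((t - p) / 2)| =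
      2 * (Real.sin p / |Real.cos t - Real.cos p|) := by
  obtain ⟨h1, h2⟩ := abs_lt.1 ht
  have h3 := le_abs_self t
  have h4 := neg_abs_le t
  have hc : Real.cos p < Real.cos t := by
    rw [← Real.cos_abs t]
    exact Real.cos_lt_cos_of_nonneg_of_le_pi (abs_nonneg t) (by linarith [abs_nonneg t]) ht
  have hs1 : 0 < Real.sin ((t + p) / 2) :=
    Real.sin_pos_of_pos_of_lt_pi (by linarith) (by linarith)
  have hs2 : Real.sin ((t - p) / 2) < 0 :=
    Real.sin_neg_of_neg_of_neg_pi_lt (by linarith) (by linarith)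
  have hc1 : 0 < Real.cos ((t + p) / 2) := Real.cos_pos_of_mem_Ioo ⟨by linarith, by linarith⟩
  have hc2 : 0 < Real.cos ((t - p) / 2) := Real.cos_pos_of_mem_Ioo ⟨by linarith, by linarith⟩
  rw [abs_of_pos (sub_pos.2 hc), sin_div_cos_sub_cos hs2.ne hs1.ne']
  have e1 : 0 < Real.cot ((t + p) / 2) := by rw [Real.cot_eq_cos_div_sin]; positivity
  have e2 : Real.cot ((t - p) / 2) < 0 := by
    rw [Real.cot_eq_cos_div_sin]; exact div_neg_of_pos_of_neg hc2 hs2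
  rw [abs_of_pos e1, abs_of_neg e2]
  ring

theorem sin_div_abs_cos_sub_cos_le {t p : ℝ} (h : Real.cos t ≠ Real.cos p) (hp : 0 ≤ Real.sin p) :
    2 * (Real.sin p / |Real.cos t - Real.cos p|) ≤
      |Real.cot ((t + p) / 2)| + |Real.cot ((t - p) / 2)| := by
  have hne : Real.sin ((t + p) / 2) ≠ 0 ∧ Real.sin ((t - p) / 2) ≠ 0 := by
    have := sub_ne_zero.2 h
    rw [Real.cos_sub_cos] at this
    constructor <;> intro h0 <;> simp [h0] at this
  have e := congrArg abs (sin_div_cos_sub_cos hne.2 hne.1)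
  rw [abs_div, abs_of_nonneg hp, abs_div, abs_two] at e
  rw [e]
  have := abs_sub (Real.cot ((t + p) / 2)) (Real.cot ((t - p) / 2))
  linarith

/-! ### The Lebesgue function and its maximum -/

/-- The Lebesgue function of the Chebyshev nodes. -/
noncomputable def chebyshevLebesgue (n : ℕ) (y : ℝ) : ℝ :=
  ∑ k, |(Lagrange.basis Finset.univ (fun j : Fin n => (chebyshevNode n j : ℝ)) k).eval y|

theorem chebyshevLebesgue_cos {n : ℕ} {t : ℝ}
    (ht : ∀ k < n, Real.cos t ≠ Real.cos (chebyshevAngle n k)) :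
    chebyshevLebesgue n (Real.cos t) = (n : ℝ)⁻¹ * (|Real.cos (n * t)| *
      ∑ k ∈ Finset.range n, Real.sin (chebyshevAngle n k) /
        |Real.cos t - Real.cos (chebyshevAngle n k)|) := by
  unfold chebyshevLebesgue
  simp_rw [fun k : Fin n => abs_eval_basis_chebyshevNode k (ht k k.2)]
  rw [Fin.sum_univ_eq_sum_range (fun k => (n : ℝ)⁻¹ * (|Real.cos (n * t)| *
    Real.sin (chebyshevAngle n k) / |Real.cos t - Real.cos (chebyshevAngle n k)|)),
    Finset.mul_sum, Finset.mul_sum]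
  exact Finset.sum_congr rfl fun k _ => by ring

theorem chebyshevLebesgue_node {n : ℕ} (k : Fin n) :
    chebyshevLebesgue n (chebyshevNode n k) = 1 := by
  unfold chebyshevLebesgue
  rw [Finset.sum_eq_single k]
  · rw [Lagrange.eval_basis_self (v := fun j : Fin n => (chebyshevNode n j : ℝ))
      ((chebyshevNode_injective n).injOn) (Finset.mem_univ k), abs_one]
  · intro j _ hj
    rw [Lagrange.eval_basis_of_ne (v := fun j : Fin n => (chebyshevNode n j : ℝ)) hj
      (Finset.mem_univ k), abs_zero]
  · simp

/-- To the right of all nodes every factor `|y - x_j|` grows with `y`. -/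
theorem chebyshevLebesgue_mono {n : ℕ} {y z : ℝ} (hy : ∀ k, (chebyshevNode n k : ℝ) ≤ y)
    (hyz : y ≤ z) : chebyshevLebesgue n y ≤ chebyshevLebesgue n z := by
  refine Finset.sum_le_sum fun k _ => ?_
  simp only [Lagrange.basis, Lagrange.basisDivisor, Polynomial.eval_prod, Polynomial.eval_mul,
    Polynomial.eval_C, Polynomial.eval_sub, Polynomial.eval_X, Finset.abs_prod, abs_mul]
  refine Finset.prod_le_prod (fun j _ => by positivity) fun j _ => ?_
  gcongr
  exact sub_nonneg.2 (hy j)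

theorem chebyshevLebesgue_one (n : ℕ) : chebyshevLebesgue n 1 =
    (n : ℝ)⁻¹ * ∑ k ∈ Finset.range n, Real.cot ((2 * k + 1) * (Real.pi / (4 * n))) := by
  have hlt : ∀ k < n, Real.cos (chebyshevAngle n k) < Real.cos 0 := fun k hk =>
    Real.cos_lt_cos_of_nonneg_of_le_pi le_rfl (chebyshevAngle_lt_pi hk).le
      (chebyshevAngle_pos (by omega))
  rw [← Real.cos_zero, chebyshevLebesgue_cos fun k hk => (hlt k hk).ne']
  simp only [mul_zero, Real.cos_zero, abs_one, one_mul]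
  congr 1
  refine Finset.sum_congr rfl fun k hk => ?_
  have hk := Finset.mem_range.1 hk
  have h0 := chebyshevAngle_pos (n := n) (k := k) (by omega)
  have h1 := chebyshevAngle_lt_pi hk
  have hl := hlt k hk
  rw [Real.cos_zero] at hl
  have hs : 0 < Real.sin (chebyshevAngle n k / 2) :=
    Real.sin_pos_of_pos_of_lt_pi (by linarith) (by linarith)
  have e : (2 * k + 1) * (Real.pi / (4 * n)) = chebyshevAngle n k / 2 := by
    unfold chebyshevAngle; ring
  have hn : Real.sin ((0 - chebyshevAngle n k) / 2) = -Real.sin (chebyshevAngle n k / 2) := by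
    rw [← Real.sin_neg]; congr 1; ring
  have hn' : Real.cos ((0 - chebyshevAngle n k) / 2) = Real.cos (chebyshevAngle n k / 2) := by
    rw [← Real.cos_neg]; congr 1; ring
  have h := sin_div_cos_sub_cos (t := 0) (p := chebyshevAngle n k)
    (by rw [hn]; exact (neg_neg_of_pos hs).ne)
    (by rw [zero_add]; exact hs.ne')
  rw [abs_of_pos (sub_pos.2 hl), e, ← Real.cos_zero, h, zero_add,
    Real.cot_eq_cos_div_sin ((0 - _) / 2), hn, hn', Real.cot_eq_cos_div_sin]
  ring

/-- The Lebesgue function of the Chebyshev nodes is maximal at the endpoint `1`. -/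
theorem chebyshevLebesgue_le_one {n : ℕ} {y : ℝ} (hy1 : -1 ≤ y) (hy2 : y ≤ 1)
    (hy : ∀ k : Fin n, y ≠ chebyshevNode n k) :
    chebyshevLebesgue n y ≤ chebyshevLebesgue n 1 := by
  rcases n.eq_zero_or_pos with rfl | hn
  · simp [chebyshevLebesgue]
  have hn0 : (0 : ℝ) < n := by exact_mod_cast hn
  have hpi := Real.pi_pos
  set t := Real.arccos y with ht
  have hyt : Real.cos t = y := Real.cos_arccos hy1 hy2
  have hne : ∀ k < n, Real.cos t ≠ Real.cos (chebyshevAngle n k) := fun k hk => by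
    rw [hyt, ← chebyshevNode_eq_cos ⟨k, hk⟩]; exact hy ⟨k, hk⟩
  obtain ⟨m, s, hts, hs⟩ : ∃ (m : ℕ) (s : ℝ), t = s + m * Real.pi / n ∧
      |s| ≤ Real.pi / (2 * n) := by
    -- Rounding `t` to the nearest multiple of `π/n`.
    refine ⟨⌊t * n / Real.pi + 1 / 2⌋₊, _, (sub_add_cancel _ _).symm, ?_⟩
    have h0 : 0 ≤ t * n / Real.pi + 1 / 2 := by
      have := Real.arccos_nonneg y
      positivity
    have h1 := Nat.floor_le h0
    have h2 := Nat.lt_floor_add_one (t * n / Real.pi + 1 / 2)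
    set m := ⌊t * n / Real.pi + 1 / 2⌋₊
    have e : t - m * Real.pi / n = (t * n / Real.pi - m) * (Real.pi / n) := by field_simp
    rw [e, abs_mul, abs_of_pos (div_pos hpi hn0)]
    calc _ ≤ 1 / 2 * (Real.pi / n) := by
          gcongr
          exact abs_le.2 ⟨by linarith, by linarith⟩
      _ = _ := by ring
  have hcos : |Real.cos (n * t)| = |Real.cos (n * s)| := by
    have e : n * t = n * s + m * Real.pi := by rw [hts]; field_simp
    rw [e, Real.cos_add_nat_mul_pi, abs_mul, abs_pow, abs_neg, abs_one, one_pow, one_mul]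
  -- Otherwise `T_n(y) = 0` and `y` is a node; this excludes `|s| = π/(2n)`.
  have hcos0 : Real.cos (n * t) ≠ 0 := by
    intro h0
    have hT := chebyshev_T_eq_C_mul_nodal n
    have h := Polynomial.Chebyshev.T_real_cos t n
    rw [hT, Int.cast_natCast, h0, Polynomial.eval_mul, Polynomial.eval_C, Lagrange.eval_nodal] at h
    have h' := (mul_eq_zero.1 h).resolve_left (by positivity)
    obtain ⟨k, -, hk⟩ := Finset.prod_eq_zero_iff.1 h'
    exact hy k (by rw [← hyt]; linarith)
  have hs' : |s| < Real.pi / (2 * n) := by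
    refine hs.lt_of_ne fun h => ?_
    have e : |Real.cos (n * s)| = 0 := by
      rw [← Real.cos_abs, abs_mul, h, abs_of_pos hn0]
      have : n * (Real.pi / (2 * n)) = Real.pi / 2 := by field_simp
      rw [this, Real.cos_pi_div_two, abs_zero]
    rw [← hcos] at e
    exact hcos0 (abs_eq_zero.1 e)
  have hang : ∀ k < n, |s| < chebyshevAngle n k ∧ |s| + chebyshevAngle n k < Real.pi := by
    intro k hk
    have h1 : (k : ℝ) + 1 ≤ n := by exact_mod_cast hk
    have e : chebyshevAngle n k = (2 * k + 1) * (Real.pi / (2 * n)) := by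
      unfold chebyshevAngle; ring
    have hq : 0 < Real.pi / (2 * n) := by positivity
    have hpq : Real.pi = 2 * n * (Real.pi / (2 * n)) := by field_simp
    rw [e]
    set q := Real.pi / (2 * n)
    constructor
    · nlinarith [mul_nonneg (Nat.cast_nonneg (α := ℝ) k) hq.le]
    · rw [hpq]; nlinarith [mul_le_mul_of_nonneg_right h1 hq.le]
  have hlt : ∀ k < n, Real.cos (chebyshevAngle n k) < Real.cos s := fun k hk => by
    rw [← Real.cos_abs s]
    exact Real.cos_lt_cos_of_nonneg_of_le_pi (abs_nonneg s) (chebyshevAngle_lt_pi hk).le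
      (hang k hk).1
  have hsum : ∑ k ∈ Finset.range n, 2 * (Real.sin (chebyshevAngle n k) /
        |Real.cos t - Real.cos (chebyshevAngle n k)|) ≤
      ∑ k ∈ Finset.range n, 2 * (Real.sin (chebyshevAngle n k) /
        |Real.cos s - Real.cos (chebyshevAngle n k)|) := by
    calc _ ≤ ∑ k ∈ Finset.range n, (|Real.cot ((t + chebyshevAngle n k) / 2)| +
          |Real.cot ((t - chebyshevAngle n k) / 2)|) := Finset.sum_le_sum fun k hk =>
            sin_div_abs_cos_sub_cos_le (hne k (Finset.mem_range.1 hk))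
              (sin_chebyshevAngle_pos (Finset.mem_range.1 hk)).le
      _ = ∑ k ∈ Finset.range n, (|Real.cot ((s + chebyshevAngle n k) / 2)| +
          |Real.cot ((s - chebyshevAngle n k) / 2)|) := by
        rw [sum_pair_eq_sum_range_two_mul n hn, sum_pair_eq_sum_range_two_mul n hn, hts,
          sum_abs_cot_shift hn]
      _ = _ := Finset.sum_congr rfl fun k hk =>
            abs_cot_add_abs_cot (hang k (Finset.mem_range.1 hk)).1
              (hang k (Finset.mem_range.1 hk)).2
  rw [← Finset.mul_sum, ← Finset.mul_sum] at hsum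
  calc chebyshevLebesgue n y ≤ chebyshevLebesgue n (Real.cos s) := by
        rw [← hyt, chebyshevLebesgue_cos hne, chebyshevLebesgue_cos fun k hk => (hlt k hk).ne',
          hcos]
        have := le_of_mul_le_mul_left hsum two_pos
        exact mul_le_mul_of_nonneg_left (mul_le_mul_of_nonneg_left this (abs_nonneg _))
          (inv_nonneg.2 hn0.le)
    _ ≤ chebyshevLebesgue n 1 := chebyshevLebesgue_mono
        (fun k => by rw [chebyshevNode_eq_cos]; exact (hlt k k.2).le) (Real.cos_le_one s)

theorem chebyshevLebesgue_le {n : ℕ} (hn : 1 ≤ n) {y : ℝ} (hy1 : -1 ≤ y) (hy2 : y ≤ 1) :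
    chebyshevLebesgue n y ≤ 1 + 2 / Real.pi * Real.log n := by
  by_cases h : ∃ k : Fin n, y = chebyshevNode n k
  · obtain ⟨k, rfl⟩ := h
    rw [chebyshevLebesgue_node]
    have := Real.log_natCast_nonneg n
    have := Real.pi_pos
    have : 0 ≤ 2 / Real.pi * Real.log n := by positivity
    linarith
  · push Not at h
    refine (chebyshevLebesgue_le_one hy1 hy2 h).trans ?_
    rw [chebyshevLebesgue_one]
    exact inv_mul_sum_cot_le hn

/-! ### The interpolation operator -/

theorem norm_chebyshevLagrange_le {n : ℕ} (hn : 1 ≤ n) :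
    ‖chebyshevLagrange n‖ ≤ 1 + 2 / Real.pi * Real.log n := by
  have hB : 0 ≤ 1 + 2 / Real.pi * Real.log n := by
    have := Real.log_natCast_nonneg n
    have := Real.pi_pos
    positivity
  refine ContinuousLinearMap.opNorm_le_bound _ hB fun f => ?_
  refine (ContinuousMap.norm_le _ (by positivity)).2 fun y => ?_
  rw [chebyshevLagrange, lagrangeOperator_apply, Real.norm_eq_abs]
  calc _ ≤ ∑ k, |f (chebyshevNode n k) * lagrangeFundamental (chebyshevNode n) k y| :=
        Finset.abs_sum_le_sum_abs _ _
    _ ≤ ∑ k, ‖f‖ * |lagrangeFundamental (chebyshevNode n) k y| := by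
        refine Finset.sum_le_sum fun k _ => ?_
        rw [abs_mul]
        gcongr
        exact f.norm_coe_le_norm _
    _ = ‖f‖ * chebyshevLebesgue n y := by
        rw [← Finset.mul_sum]; rfl
    _ ≤ _ := by
        rw [mul_comm]
        gcongr
        exact chebyshevLebesgue_le hn y.2.1 y.2.2

theorem chebyshevLagrange_one {n : ℕ} (hn : 1 ≤ n) : chebyshevLagrange n 1 = 1 := by
  ext y
  have : NeZero n := ⟨by omega⟩
  have h := congrArg (Polynomial.eval (y : ℝ)) (Lagrange.sum_basis (s := Finset.univ)
    (v := fun j : Fin n => (chebyshevNode n j : ℝ)) (chebyshevNode_injective n).injOn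
    Finset.univ_nonempty)
  rw [Polynomial.eval_finsetSum, Polynomial.eval_one] at h
  rw [chebyshevLagrange, lagrangeOperator_apply]
  simpa [lagrangeFundamental] using h

/-! ### Modulus of continuity and its majorant -/

theorem bddAbove_modulus {X : Type*} [MetricSpace X] [CompactSpace X] (f : C(X, ℝ)) (t : ℝ) :
    BddAbove {r : ℝ | ∃ x y : X, dist x y ≤ t ∧ r = |f x - f y|} := by
  refine ⟨‖f‖ + ‖f‖, ?_⟩
  rintro r ⟨x, y, -, rfl⟩
  exact (abs_sub _ _).trans (add_le_add (f.norm_coe_le_norm x) (f.norm_coe_le_norm y))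

theorem abs_sub_le_modulus {X : Type*} [MetricSpace X] [CompactSpace X] (f : C(X, ℝ)) {t : ℝ}
    {x y : X} (h : dist x y ≤ t) : |f x - f y| ≤ modulus f t :=
  le_csSup (bddAbove_modulus f t) ⟨x, y, h, rfl⟩

theorem modulus_nonneg {X : Type*} [MetricSpace X] [CompactSpace X] (f : C(X, ℝ)) (t : ℝ) :
    0 ≤ modulus f t := by
  refine Real.sSup_nonneg ?_
  rintro r ⟨x, y, -, rfl⟩
  exact abs_nonneg _

/-- At `t = diam` the constraints force `b = t`, so every quotient collapses to `modulus f t`;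
positive diameter makes `a = 0` admissible. -/
theorem modulusMajorant_diam {X : Type*} [MetricSpace X] [CompactSpace X] (f : C(X, ℝ))
    (h : 0 < Metric.diam (univ : Set X)) :
    modulusMajorant f (Metric.diam (univ : Set X)) = modulus f (Metric.diam (univ : Set X)) := by
  unfold modulusMajorant
  rw [if_pos le_rfl]
  refine (congrArg sSup ?_).trans (csSup_singleton (modulus f (Metric.diam (univ : Set X))))
  ext r
  simp only [mem_ofPred_eq, mem_singleton_iff]
  constructor
  · rintro ⟨a, b, -, -, h1, h2, hne, rfl⟩
    obtain rfl := le_antisymm h1 h2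
    have := sub_ne_zero.2 hne.symm
    rw [sub_self, zero_mul, add_zero, mul_div_cancel_left₀ _ this]
  · rintro rfl
    refine ⟨0, _, le_rfl, h.le, le_rfl, le_rfl, h.ne, ?_⟩
    rw [sub_self, zero_mul, add_zero, mul_div_cancel_left₀ _ (by simpa using h.ne')]

theorem diam_univ_Icc : Metric.diam (univ : Set (Icc (-1 : ℝ) 1)) = 2 := by
  have h := (isometry_subtype_coe (s := Icc (-1 : ℝ) 1)).diam_image univ
  rw [← h, image_univ, Subtype.range_coe, Real.diam_Icc (by norm_num)]
  norm_num

theorem dist_le_two (u v : Icc (-1 : ℝ) 1) : dist u v ≤ 2 := by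
  rw [← diam_univ_Icc]
  exact Metric.dist_le_diam_of_mem isCompact_univ.isBounded (mem_univ u) (mem_univ v)

theorem exists_norm_sub_const_le_modulus (f : C(Icc (-1 : ℝ) 1, ℝ)) :
    ∃ c : ℝ, ‖f - c • (1 : C(Icc (-1 : ℝ) 1, ℝ))‖ ≤ modulus f 2 / 2 := by
  have : Nonempty (Icc (-1 : ℝ) 1) := ⟨⟨0, by norm_num⟩⟩
  obtain ⟨u, -, hu⟩ := isCompact_univ.exists_isMaxOn univ_nonempty f.continuous.continuousOn
  obtain ⟨v, -, hv⟩ := isCompact_univ.exists_isMinOn univ_nonempty f.continuous.continuousOn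
  refine ⟨(f u + f v) / 2, (ContinuousMap.norm_le _ (by
    have := modulus_nonneg f 2; positivity)).2 fun y => ?_⟩
  have h1 : f y ≤ f u := hu (mem_univ y)
  have h2 : f v ≤ f y := hv (mem_univ y)
  have h3 := (le_abs_self _).trans (abs_sub_le_modulus f (dist_le_two u v))
  simp only [ContinuousMap.sub_apply, ContinuousMap.smul_apply, ContinuousMap.one_apply,
    smul_eq_mul, mul_one, Real.norm_eq_abs]
  exact abs_le.2 ⟨by linarith, by linarith⟩

/-! ### Bounding the Chebyshev functional -/

theorem chebyshevFunctional_sub_const {X : Type*} [MetricSpace X] [CompactSpace X]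
    {H : C(X, ℝ) →L[ℝ] C(X, ℝ)} (hH : H 1 = 1) (f g : C(X, ℝ)) (c d : ℝ) (x : X) :
    chebyshevFunctional H (f - c • 1) (g - d • 1) x = chebyshevFunctional H f g x := by
  have e : (f - c • 1) * (g - d • 1) = f * g - d • f - c • g + (c * d) • (1 : C(X, ℝ)) := by
    ext y; simp; ring
  unfold chebyshevFunctional
  rw [e]
  simp only [map_add, map_sub, map_smul, hH, ContinuousMap.add_apply, ContinuousMap.sub_apply,
    ContinuousMap.smul_apply, ContinuousMap.one_apply, smul_eq_mul]
  ring

theorem abs_chebyshevFunctional_le_norm {X : Type*} [MetricSpace X] [CompactSpace X]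
    (H : C(X, ℝ) →L[ℝ] C(X, ℝ)) (f g : C(X, ℝ)) (x : X) :
    |chebyshevFunctional H f g x| ≤ ‖H‖ * (1 + ‖H‖) * (‖f‖ * ‖g‖) := by
  have h : ∀ q : C(X, ℝ), |H q x| ≤ ‖H‖ * ‖q‖ := fun q =>
    ((H q).norm_coe_le_norm x).trans (H.le_opNorm q)
  calc |chebyshevFunctional H f g x| ≤ |H (f * g) x| + |H f x * H g x| := abs_sub _ _
    _ ≤ ‖H‖ * (‖f‖ * ‖g‖) + (‖H‖ * ‖f‖) * (‖H‖ * ‖g‖) := by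
        rw [abs_mul]
        gcongr
        · exact (h _).trans (by gcongr; exact norm_mul_le f g)
        · exact h f
        · exact h g
    _ = _ := by ring

theorem mainTheorem7 (n : ℕ) (hn : 1 ≤ n) (f g : C(Icc (-1 : ℝ) 1, ℝ)) (x : Icc (-1 : ℝ) 1) :
    |chebyshevFunctional (chebyshevLagrange n) f g x| ≤
        1 / 4 * ‖chebyshevLagrange n‖ * (1 + ‖chebyshevLagrange n‖) *
          (modulusMajorant f 2 * modulusMajorant g 2) ∧
    1 / 4 * ‖chebyshevLagrange n‖ * (1 + ‖chebyshevLagrange n‖) *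
          (modulusMajorant f 2 * modulusMajorant g 2) ≤
        1 / 2 * (1 + 3 / Real.pi * Real.log n + 2 / Real.pi ^ 2 * Real.log n ^ 2) *
          (modulus f 2 * modulus g 2) ∧
    1 / 2 * (1 + 3 / Real.pi * Real.log n + 2 / Real.pi ^ 2 * Real.log n ^ 2) *
          (modulus f 2 * modulus g 2) ≤
        1 / 2 * (1 + 3 / Real.pi * Real.log n + 2 / Real.pi * Real.log n ^ 2) *
          (modulus f 2 * modulus g 2) := by
  have hmaj : ∀ q : C(Icc (-1 : ℝ) 1, ℝ), modulusMajorant q 2 = modulus q 2 := fun q => by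
    have h := modulusMajorant_diam q (by rw [diam_univ_Icc]; norm_num)
    rwa [diam_univ_Icc] at h
  rw [hmaj f, hmaj g]
  have hf := modulus_nonneg f 2
  have hg := modulus_nonneg g 2
  have hpi := Real.pi_gt_three
  have hlog := Real.log_natCast_nonneg n
  refine ⟨?_, ?_, ?_⟩
  · obtain ⟨c, hc⟩ := exists_norm_sub_const_le_modulus f
    obtain ⟨d, hd⟩ := exists_norm_sub_const_le_modulus g
    rw [← chebyshevFunctional_sub_const (chebyshevLagrange_one hn) f g c d x]
    refine (abs_chebyshevFunctional_le_norm _ _ _ x).trans ?_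
    calc _ ≤ ‖chebyshevLagrange n‖ * (1 + ‖chebyshevLagrange n‖) *
          (modulus f 2 / 2 * (modulus g 2 / 2)) := by gcongr
      _ = _ := by ring
  · have hL := norm_chebyshevLagrange_le hn
    refine mul_le_mul_of_nonneg_right ?_ (mul_nonneg hf hg)
    calc 1 / 4 * ‖chebyshevLagrange n‖ * (1 + ‖chebyshevLagrange n‖)
        ≤ 1 / 4 * (1 + 2 / Real.pi * Real.log n) *
          (1 + (1 + 2 / Real.pi * Real.log n)) := by gcongr
      _ = _ := by ring
  · gcongr
    -- Amounts to `π ≤ π ^ 2`.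
    nlinarith
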